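/- For every positive integer $N$ let $a^{(N)}=(a_{ij})_{1\le i,j\le N}$ and $b^{(N)}=(b_{ij})_{1\le i,j\le N}$ be real arrays (their entries may depend on $N$) such that $a_{ij}=a_{ji}$, $b_{ij}=b_{ji}$ for all $i,j$, and $$\sum_{i,j=1}^N a_{ij}=\sum_{i,j=1}^N b_{ij}=0 .$$ The diagonal entries are not required to vanish. Suppose that for all sufficiently large $N$ neither array is identically zero, and that, as $N\to\infty$, $$\sum_{i,j,k=1}^N a_{ij}a_{ik}\asymp N^3\Bigl(\max_{i,j}|a_{ij}|\Bigr)^2,\qquad \sum_{i,j,k=1}^N b_{ij}b_{ik}\asymp N^3\Bigl(\max_{i,j}|b_{ij}|\Bigr)^2,$$ where $x_N\asymp y_N$ means that there are constants $0<c\le C<\infty$ with $c\,|y_N|\le |x_N|\le C\,|y_N|$ for all sufficiently large $N$. Let $\pi$ be a uniformly random permutation of $\{1,\dots,N\}$ (each with probability $1/N!$) and $$\Gamma=\Gamma_N=\sum_{i=1}^N\sum_{j=1}^N a_{ij}\,b_{\pi(i)\pi(j)} .$$ Then $$\frac{\Gamma_N}{2\sqrt{\Bigl(\sum_{i,j,k}a_{ij}a_{ik}\Bigr)\Bigl(\sum_{i,j,k}b_{ij}b_{ik}\Bigr)\Big/N^3}}\;\longrightarrow\;N(0,1)\quad\text{in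 distribution, as } N\to\infty .$$ -/

import Mathlib

open Filter Asymptotics MeasureTheory ProbabilityTheory

namespace GenCorr

/-- Every set of permutations is an event. -/
instance permMeasurableSpace (N : ℕ) : MeasurableSpace (Equiv.Perm (Fin N)) := ⊤

/-- The uniform probability measure on the permutations of the `N` indices. -/
noncomputable def permMeasure (N : ℕ) : Measure (Equiv.Perm (Fin N)) :=
  (PMF.uniformOfFintype (Equiv.Perm (Fin N))).toMeasure

instance permMeasure_isProbabilityMeasure (N : ℕ) : IsProbabilityMeasure (permMeasure N) :=
  PMF.toMeasure.isProbabilityMeasure _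

/-- The largest absolute value of an entry (`0` for the empty array). -/
noncomputable def maxAbs {N : ℕ} (a : Matrix (Fin N) (Fin N) ℝ) : ℝ :=
  ⨆ p : Fin N × Fin N, |a p.1 p.2|

/-- The sum `∑ a_{ij} a_{ik}` over all triples `(i, j, k)`. -/
def tripleSum {N : ℕ} (a : Matrix (Fin N) (Fin N) ℝ) : ℝ :=
  ∑ i, ∑ j, ∑ k, a i j * a i k

/-- The permuted generalized correlation coefficient `Γ`. -/
def gammaStat {N : ℕ} (a b : Matrix (Fin N) (Fin N) ℝ) (π : Equiv.Perm (Fin N)) : ℝ :=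
  ∑ i, ∑ j, a i j * b (π i) (π j)

end GenCorr

namespace GenCorr

open Finset Equiv
open scoped BigOperators

/-! The standardized statistic is invariant under positive scaling, so both arrays may be taken with
entries of absolute value at most 1. Let `r`, `s` be the row sums of `a`, `b`. Splitting each array
into its additive part `(r i + r j) / N` and a remainder with zero row sums gives Γ = (2/N) ∑ r_i
s_{π(i)} + R (`gammaStat_eq`). The lower bounds on the triple sums make the linear term of order
N^{3/2}, while E R² = O(N²) (`expect_quadratic_sq_le`), so R is negligible.

The linear statistic W is handled by Stein's exchangeable pair (π, π ∘ transposition), used directly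
on the characteristic function. With d the decrease of W under a swap of i and j, 4N E[W F] = E ∑ d
(F(π) - F(π ∘ swap)) (`expect_linStat_mul`). For F = exp(isW), Taylor expansion leaves is ∑ d² F,
and ∑ d² concentrates around 4Nσ². Hence the characteristic function ψ of W/σ nearly solves ψ' =
-uψ, which forces it close to exp(-t²/2) with error O(N^{-1/2}). Lévy's continuity theorem
concludes. -/

lemma expect_abs_le_sqrt {α : Type*} [Fintype α] [Nonempty α] (Z : α → ℝ) :
    𝔼 i, |Z i| ≤ √(𝔼 i, Z i ^ 2) := by
  refine Real.le_sqrt_of_sq_le ?_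
  have h : 0 ≤ 𝔼 i, (|Z i| - 𝔼 j, |Z j|) ^ 2 := expect_nonneg fun i _ => sq_nonneg _
  simp only [sub_sq, sq_abs, expect_add_distrib, expect_sub_distrib, ← mul_expect, ← expect_mul,
    Fintype.expect_const] at h
  nlinarith

lemma norm_expect_le_of_le {α : Type*} [Fintype α] {F : α → ℂ} {g : α → ℝ}
    (h : ∀ i, ‖F i‖ ≤ g i) : ‖𝔼 i, F i‖ ≤ 𝔼 i, g i :=
  (RCLike.norm_expect_le (K := ℂ)).trans (expect_le_expect fun i _ => h i)

lemma sum_sum_sub_mul_sub {ι : Type*} [Fintype ι] (u v : ι → ℝ) (hu : ∑ i, u i = 0) :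
    ∑ i, ∑ j, (u i - u j) * (v i - v j) = 2 * Fintype.card ι * ∑ i, u i * v i := by
  have h : ∀ i j, (u i - u j) * (v i - v j) = u i * v i + u j * v j - u i * v j - u j * v i :=
    fun i j => by ring
  simp only [h, sum_sub_distrib, sum_add_distrib, sum_const, card_univ, nsmul_eq_mul]
  simp only [← mul_sum, ← sum_mul, hu]
  ring

/-- For `v = y ∘ π` this is the sum of squared swap increments of W: a fluctuating linear statistic
of the squares, a deterministic term, and 4W². -/
lemma sum_sum_sub_mul_sub_sq {ι : Type*} [Fintype ι] (u v : ι → ℝ)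
    (hu : ∑ i, u i = 0) (hv : ∑ i, v i = 0) :
    ∑ i, ∑ j, ((u i - u j) * (v i - v j)) ^ 2
      = 2 * Fintype.card ι * (∑ i, u i ^ 2 * v i ^ 2) + 2 * (∑ i, u i ^ 2) * (∑ i, v i ^ 2)
        + 4 * (∑ i, u i * v i) ^ 2 := by
  have h : ∀ i j, ((u i - u j) * (v i - v j)) ^ 2 = u i ^ 2 * v i ^ 2 + u j ^ 2 * v j ^ 2
      + u i ^ 2 * v j ^ 2 + v i ^ 2 * u j ^ 2 + 4 * ((u i * v i) * (u j * v j))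
      - 2 * (u i ^ 2 * v i * v j) - 2 * (u i * v i ^ 2 * u j)
      - 2 * (u i * (u j * v j ^ 2)) - 2 * (v i * (v j * u j ^ 2)) :=
    fun i j => by ring
  simp only [h, sum_sub_distrib, sum_add_distrib, sum_const, card_univ, nsmul_eq_mul]
  simp only [← mul_sum, ← sum_mul, hu, hv]
  ring

/-! ### Exchangeable pairs for linear permutation statistics -/

section Perm

variable {ι : Type*} [Fintype ι] [DecidableEq ι]

/-- The linear permutation statistic `∑ x_i y_{π(i)}`. -/
def linStat (x y : ι → ℝ) (π : Perm ι) : ℝ := ∑ i, x i * y (π i)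

lemma linStat_mul_swap (x y : ι → ℝ) (π : Perm ι) (i j : ι) :
    linStat x y (π * swap i j) = linStat x y π - (x i - x j) * (y (π i) - y (π j)) := by
  have h : ∀ k, x k * y ((π * swap i j) k) = x k * y (π k)
      + ((if k = i then x k * (y (π j) - y (π i)) else 0)
        + (if k = j then x k * (y (π i) - y (π j)) else 0)) := by
    intro k
    rw [Perm.mul_apply, swap_apply_def]
    split_ifs with h1 h2 h2
    · subst h1; subst h2; ring
    · subst h1; ring
    · subst h2; ring
    · ring
  simp only [linStat, h, sum_add_distrib, sum_ite_eq', mem_univ, if_true]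
  ring

lemma expect_comp_mul_right {E : Type*} [AddCommMonoid E] [Module ℚ≥0 E]
    (F : Perm ι → E) (τ : Perm ι) : 𝔼 π, F (π * τ) = 𝔼 π, F π :=
  Fintype.expect_equiv (Equiv.mulRight τ) _ _ fun _ => rfl

lemma expect_eval (g : ι → ℝ) (i : ι) : 𝔼 π : Perm ι, g (π i) = (∑ j, g j) / Fintype.card ι := by
  have h : ∀ j, 𝔼 π : Perm ι, g (π j) = 𝔼 π : Perm ι, g (π i) := by
    intro j
    rw [← expect_comp_mul_right _ (swap i j)]
    simp
  have hn : (Fintype.card ι : ℝ) ≠ 0 := by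
    have : Nonempty ι := ⟨i⟩
    exact_mod_cast Fintype.card_ne_zero
  have h2 : ∑ j, 𝔼 π : Perm ι, g (π j) = ∑ j, g j := by
    rw [← expect_sum_comm]
    simp only [Equiv.sum_comp]
    exact Fintype.expect_const _
  rw [sum_congr rfl fun j _ => h j, sum_const, card_univ, nsmul_eq_mul] at h2
  rw [← h2]; field_simp

/-- The exchangeable pair identity for a linear permutation statistic. -/
lemma expect_linStat_mul {𝕜 : Type*} [RCLike 𝕜] (x y : ι → ℝ) (hx : ∑ i, x i = 0)
    (F : Perm ι → 𝕜) :
    4 * (Fintype.card ι : 𝕜) * 𝔼 π, (linStat x y π : 𝕜) * F π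
      = 𝔼 π, ∑ i, ∑ j, (((x i - x j) * (y (π i) - y (π j)) : ℝ) : 𝕜)
          * (F π - F (π * swap i j)) := by
  have hpair : ∀ i j, 𝔼 π : Perm ι, (((x i - x j) * (y (π i) - y (π j)) : ℝ) : 𝕜)
      * (F π - F (π * swap i j))
      = 2 * 𝔼 π : Perm ι, (((x i - x j) * (y (π i) - y (π j)) : ℝ) : 𝕜) * F π := by
    intro i j
    -- Right translation by the swap preserves the uniform law and flips the sign of `y (π i) - y (π
    -- j)`.
    have h1 : 𝔼 π : Perm ι, (((x i - x j) * (y (π i) - y (π j)) : ℝ) : 𝕜) * F (π * swap i j)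
        = - 𝔼 π : Perm ι, (((x i - x j) * (y (π i) - y (π j)) : ℝ) : 𝕜) * F π := by
      rw [← expect_comp_mul_right _ (swap i j), ← expect_neg_distrib]
      refine expect_congr rfl fun π _ => ?_
      simp only [mul_assoc, swap_mul_self, mul_one, Perm.mul_apply, swap_apply_left,
        swap_apply_right]
      push_cast
      ring
    rw [expect_congr rfl fun π _ => mul_sub _ (F π) _, expect_sub_distrib, h1]
    ring
  have hsum : ∀ π : Perm ι, (2 * (Fintype.card ι : 𝕜)) * ((linStat x y π : 𝕜) * F π)
      = ∑ i, ∑ j, (((x i - x j) * (y (π i) - y (π j)) : ℝ) : 𝕜) * F π := by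
    intro π
    simp only [← sum_mul]
    have := sum_sum_sub_mul_sub x (fun i => y (π i)) hx
    have h2 : ((∑ i, ∑ j, (x i - x j) * (y (π i) - y (π j)) : ℝ) : 𝕜)
        = ((2 * Fintype.card ι * linStat x y π : ℝ) : 𝕜) := by rw [this]; rfl
    push_cast at h2 ⊢
    rw [h2]; ring
  have h3 : 𝔼 π, ((2 * (Fintype.card ι : 𝕜)) * ((linStat x y π : 𝕜) * F π))
      = 𝔼 π : Perm ι, ∑ i, ∑ j, (((x i - x j) * (y (π i) - y (π j)) : ℝ) : 𝕜) * F π :=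
    expect_congr rfl fun π _ => hsum π
  rw [← mul_expect] at h3
  simp only [expect_sum_comm, hpair, ← mul_sum] at h3 ⊢
  rw [← h3]; ring

lemma expect_sum_mul_comp (u v : ι → ℝ) :
    𝔼 π : Perm ι, ∑ i, u i * v (π i) = (∑ i, u i) * (∑ i, v i) / Fintype.card ι := by
  rw [expect_sum_comm]
  simp only [← mul_expect, expect_eval, ← sum_mul]
  ring

/-- Take F = W in the exchangeable pair identity. The squared increments contain 4W² again, and
solving for the second moment turns n into n - 1. -/
lemma expect_linStat_sq (x y : ι → ℝ) (hx : ∑ i, x i = 0) (hy : ∑ i, y i = 0)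
    (hn : 2 ≤ Fintype.card ι) :
    𝔼 π, linStat x y π ^ 2 = (∑ i, x i ^ 2) * (∑ i, y i ^ 2) / (Fintype.card ι - 1) := by
  have h := expect_linStat_mul x y hx (fun π => linStat x y π)
  have h2 : ∀ π : Perm ι, ∑ i, ∑ j, ((x i - x j) * (y (π i) - y (π j)))
      * (linStat x y π - linStat x y (π * swap i j))
      = 2 * Fintype.card ι * (∑ i, x i ^ 2 * y (π i) ^ 2) + 2 * (∑ i, x i ^ 2) * (∑ i, y i ^ 2)
        + 4 * linStat x y π ^ 2 := by
    intro π
    have := sum_sum_sub_mul_sub_sq x (fun i => y (π i)) hx (by rw [Equiv.sum_comp]; exact hy)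
    rw [Equiv.sum_comp π (fun i => y i ^ 2)] at this
    rw [show linStat x y π = ∑ i, x i * y (π i) from rfl, ← this]
    refine sum_congr rfl fun i _ => sum_congr rfl fun j _ => ?_
    rw [linStat_mul_swap, linStat]; ring
  simp only [RCLike.ofReal_real_eq_id, id, h2, expect_add_distrib, ← mul_expect,
    expect_sum_mul_comp (fun i => x i ^ 2) (fun i => y i ^ 2)] at h
  rw [Fintype.expect_const] at h
  simp only [← sq] at h
  have hn' : (2 : ℝ) ≤ Fintype.card ι := by exact_mod_cast hn
  have h0 : (Fintype.card ι : ℝ) ≠ 0 := by positivity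
  rw [eq_div_iff (by linarith)]
  field_simp at h
  linarith

end Perm

/-! ### Characteristic functions and the approximate Gaussian equation -/

section CharFun

lemma norm_exp_mul_I_sub_one_sub_le (u : ℝ) :
    ‖Complex.exp (u * Complex.I) - 1 - u * Complex.I‖ ≤ 2 * u ^ 2 := by
  have hn : ‖(u : ℂ) * Complex.I‖ = |u| := by simp
  rcases le_total |u| 1 with h | h
  · have := Complex.norm_exp_sub_one_sub_id_le (x := u * Complex.I) (by rw [hn]; exact h)
    rw [hn, sq_abs] at this
    nlinarith [sq_nonneg u]
  · have h1 : ‖Complex.exp (u * Complex.I) - 1‖ ≤ |u| := by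
      rw [mul_comm]; exact Real.norm_exp_I_mul_ofReal_sub_one_le
    have h2 := norm_sub_le (Complex.exp (u * Complex.I) - 1) (u * Complex.I)
    rw [hn] at h2
    nlinarith [sq_abs u]

/-- A function that almost solves the differential equation of the standard Gaussian
characteristic function is close to it. -/
lemma norm_sub_exp_neg_sq_le {ψ ψ' : ℝ → ℂ} (hψ : ∀ u, HasDerivAt ψ (ψ' u) u) (h0 : ψ 0 = 1)
    {t ε : ℝ} (hε : ∀ u, |u| ≤ |t| → ‖ψ' u + u * ψ u‖ ≤ ε) :
    ‖ψ t - Complex.exp (-(t : ℂ) ^ 2 / 2)‖ ≤ |t| * Real.exp (t ^ 2 / 2) * ε := by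
  -- Integrating factor: the defect of the equation is the whole derivative of this product, so the
  -- mean value inequality applies.
  have hd : ∀ u : ℝ, HasDerivAt (fun u : ℝ => ψ u * Complex.exp ((u : ℂ) ^ 2 / 2))
      ((ψ' u + u * ψ u) * Complex.exp ((u : ℂ) ^ 2 / 2)) u := by
    intro u
    have h1 : HasDerivAt (fun u : ℝ => Complex.exp ((u : ℂ) ^ 2 / 2))
        (Complex.exp ((u : ℂ) ^ 2 / 2) * u) u := by
      have h2 : HasDerivAt (fun u : ℝ => (u : ℂ) ^ 2 / 2) (u : ℂ) u := by
        have := ((Complex.ofRealCLM.hasDerivAt (x := u)).pow 2).div_const 2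
        refine this.congr_deriv ?_
        simp
      exact h2.cexp
    refine ((hψ u).mul h1).congr_deriv ?_
    ring
  have hnorm : ∀ u : ℝ, ‖Complex.exp ((u : ℂ) ^ 2 / 2)‖ = Real.exp (u ^ 2 / 2) := by
    intro u
    rw [Complex.norm_exp]
    norm_cast
  have hε0 : 0 ≤ ε := (norm_nonneg _).trans (hε t le_rfl)
  have hb := (convex_Icc (-|t|) |t|).norm_image_sub_le_of_norm_hasDerivWithin_le
    (f := fun u : ℝ => ψ u * Complex.exp ((u : ℂ) ^ 2 / 2)) (C := ε * Real.exp (t ^ 2 / 2))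
    (x := 0) (y := t)
    (fun u _ => (hd u).hasDerivWithinAt) (fun u hu => by
      have hu' : |u| ≤ |t| := abs_le.2 hu
      rw [norm_mul, hnorm]
      have := sq_le_sq.2 hu'
      gcongr
      exact hε u hu') (by simp) (by simp [neg_abs_le, le_abs_self])
  simp only [Complex.ofReal_zero, h0] at hb
  have hfac : ψ t - Complex.exp (-(t : ℂ) ^ 2 / 2)
      = (ψ t * Complex.exp ((t : ℂ) ^ 2 / 2) - 1) * Complex.exp (-(t : ℂ) ^ 2 / 2) := by
    rw [sub_mul, mul_assoc, ← Complex.exp_add]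
    ring_nf
    simp
  have hle : ‖Complex.exp (-(t : ℂ) ^ 2 / 2)‖ ≤ 1 := by
    rw [Complex.norm_exp, Real.exp_le_one_iff]
    norm_cast
    nlinarith [sq_nonneg t]
  rw [hfac, norm_mul]
  refine (mul_le_of_le_one_right (norm_nonneg _) hle).trans ?_
  norm_num at hb
  linarith

variable {ι : Type*} [Fintype ι] [DecidableEq ι]

/-- Approximate Stein equation for exp(isW). The term in s² is the Taylor error; the term in |s|
comes from the fluctuation of ∑ d². -/
lemma norm_expect_linStat_mul_exp_sub_le (x y : ι → ℝ) (hx : ∑ i, x i = 0) (hy : ∑ i, y i = 0)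
    (hx1 : ∀ i, |x i| ≤ 1) (hy1 : ∀ i, |y i| ≤ 1) (hn : 2 ≤ Fintype.card ι) (s : ℝ) :
    ‖(𝔼 π, (linStat x y π : ℂ) * Complex.exp (s * linStat x y π * Complex.I))
      - s * Complex.I * ((∑ i, x i ^ 2) * (∑ i, y i ^ 2) / Fintype.card ι : ℝ)
        * 𝔼 π, Complex.exp (s * linStat x y π * Complex.I)‖
      ≤ |s| * (√(Fintype.card ι) + 2) + 32 * Fintype.card ι * s ^ 2 := by
  set n : ℝ := ((Fintype.card ι : ℕ) : ℝ) with hndef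
  have hn2 : (2 : ℝ) ≤ n := by rw [hndef]; exact_mod_cast hn
  set A := ∑ i, x i ^ 2 with hA
  set B := ∑ i, y i ^ 2 with hB
  set F : Perm ι → ℂ := fun π => Complex.exp (s * linStat x y π * Complex.I) with hF
  have hF1 : ∀ π, ‖F π‖ = 1 := fun π => by
    have := Complex.norm_exp_ofReal_mul_I (s * linStat x y π)
    push_cast at this
    exact this
  set d : Perm ι → ι → ι → ℝ := fun π i j => (x i - x j) * (y (π i) - y (π j)) with hd
  have hd4 : ∀ π i j, |d π i j| ≤ 4 := by
    intro π i j
    rw [hd, abs_mul]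
    have h1 : |x i - x j| ≤ 2 := (abs_sub _ _).trans (by linarith [hx1 i, hx1 j])
    have h2 : |y (π i) - y (π j)| ≤ 2 := (abs_sub _ _).trans (by linarith [hy1 (π i), hy1 (π j)])
    calc _ ≤ (2 : ℝ) * 2 := mul_le_mul h1 h2 (abs_nonneg _) (by norm_num)
      _ = 4 := by norm_num
  set S : Perm ι → ℝ := fun π => ∑ i, x i ^ 2 * y (π i) ^ 2 with hS
  have hsumd : ∀ π, ∑ i, ∑ j, d π i j ^ 2 = 2 * n * S π + 2 * A * B + 4 * linStat x y π ^ 2 := by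
    intro π
    have := sum_sum_sub_mul_sub_sq x (fun i => y (π i)) hx (by rw [Equiv.sum_comp]; exact hy)
    rw [Equiv.sum_comp π (fun i => y i ^ 2)] at this
    exact this
  have hid := expect_linStat_mul (𝕜 := ℂ) x y hx F
  -- Taylor expansion of the increments
  have htaylor : ‖(𝔼 π, ∑ i, ∑ j, ((d π i j : ℝ) : ℂ) * (F π - F (π * swap i j)))
      - 𝔼 π, s * Complex.I * ((∑ i, ∑ j, d π i j ^ 2 : ℝ) : ℂ) * F π‖ ≤ 128 * n ^ 2 * s ^ 2 := by
    rw [← expect_sub_distrib]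
    refine (norm_expect_le_of_le (g := fun _ => 128 * n ^ 2 * s ^ 2) fun π => ?_).trans
      (Fintype.expect_const _).le
    -- The constant is |d| · 2(sd)² with |d| ≤ 4.
    have hterm : ∀ i j, ‖((d π i j : ℝ) : ℂ) * (F π - F (π * swap i j))
        - s * Complex.I * ((d π i j ^ 2 : ℝ) : ℂ) * F π‖ ≤ 128 * s ^ 2 := by
      intro i j
      have hF' : F (π * swap i j) = F π * Complex.exp ((-(s * d π i j) : ℝ) * Complex.I) := by
        rw [hF]
        simp only
        rw [linStat_mul_swap, ← Complex.exp_add]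
        congr 1
        push_cast [hd]
        ring
      have heq : ((d π i j : ℝ) : ℂ) * (F π - F (π * swap i j))
          - s * Complex.I * ((d π i j ^ 2 : ℝ) : ℂ) * F π
          = -((d π i j : ℝ) : ℂ) * F π * (Complex.exp ((-(s * d π i j) : ℝ) * Complex.I) - 1
            - (-(s * d π i j) : ℝ) * Complex.I) := by
        rw [hF']; push_cast; ring
      rw [heq, norm_mul, norm_mul, norm_neg, hF1, Complex.norm_real, mul_one, Real.norm_eq_abs]
      have h2 := norm_exp_mul_I_sub_one_sub_le (-(s * d π i j))
      have h3 : d π i j ^ 2 ≤ 16 := by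
        have := sq_le_sq' (neg_le_of_abs_le (hd4 π i j)) (le_of_abs_le (hd4 π i j))
        linarith
      calc _ ≤ 4 * (2 * (-(s * d π i j)) ^ 2) :=
            mul_le_mul (hd4 π i j) h2 (norm_nonneg _) (by norm_num)
        _ = 8 * s ^ 2 * d π i j ^ 2 := by ring
        _ ≤ 8 * s ^ 2 * 16 := by gcongr
        _ = 128 * s ^ 2 := by ring
    have hrew : (∑ i, ∑ j, ((d π i j : ℝ) : ℂ) * (F π - F (π * swap i j)))
        - s * Complex.I * ((∑ i, ∑ j, d π i j ^ 2 : ℝ) : ℂ) * F π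
        = ∑ i, ∑ j, (((d π i j : ℝ) : ℂ) * (F π - F (π * swap i j))
          - s * Complex.I * ((d π i j ^ 2 : ℝ) : ℂ) * F π) := by
      simp only [sum_sub_distrib, ← sum_mul, ← mul_sum, Complex.ofReal_sum]
    rw [hrew]
    refine (norm_sum_le_of_le _ fun i _ => norm_sum_le_of_le _ fun j _ => hterm i j).trans ?_
    simp only [sum_const, card_univ, nsmul_eq_mul, ← hndef]
    linarith
  -- fluctuation of the conditional variance
  have hVarS : 𝔼 π, |S π - A * B / n| ≤ √(4 * n) := by
    refine (expect_abs_le_sqrt _).trans (Real.sqrt_le_sqrt ?_)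
    have hcent : ∀ u : ι → ℝ, ∑ i, (u i ^ 2 - (∑ j, u j ^ 2) / n) = 0 := by
      intro u
      rw [sum_sub_distrib, sum_const, card_univ, nsmul_eq_mul, ← hndef]
      field_simp
      ring
    have hsq : ∀ u : ι → ℝ, (∀ i, |u i| ≤ 1) → ∑ i, (u i ^ 2 - (∑ j, u j ^ 2) / n) ^ 2 ≤ n := by
      intro u hu
      have hle : ∀ i, (u i ^ 2) ^ 2 ≤ 1 := fun i => by
        have h1 : u i ^ 2 ≤ 1 := (sq_le_one_iff_abs_le_one _).2 (hu i)
        nlinarith [sq_nonneg (u i)]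
      have h1 : ∑ i, (u i ^ 2) ^ 2 ≤ n := by
        refine (sum_le_sum fun i _ => hle i).trans ?_
        simp [hndef]
      have h2 : ∑ i, (u i ^ 2 - (∑ j, u j ^ 2) / n) ^ 2
          = ∑ i, (u i ^ 2) ^ 2 - (∑ j, u j ^ 2) ^ 2 / n := by
        simp only [sub_sq, sum_add_distrib, sum_sub_distrib, sum_const, card_univ, nsmul_eq_mul,
          ← hndef, ← sum_mul, ← mul_sum]
        field_simp
        ring
      rw [h2]
      have : 0 ≤ (∑ j, u j ^ 2) ^ 2 / n := by positivity
      linarith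
    -- The fluctuation of S is itself a linear permutation statistic, of the centred squares, so the
    -- exact variance formula applies to it.
    have hlin : ∀ π, S π - A * B / n
        = linStat (fun i => x i ^ 2 - A / n) (fun i => y i ^ 2 - B / n) π := by
      intro π
      have h1 : ∑ i, y (π i) ^ 2 = B := Equiv.sum_comp π (fun i => y i ^ 2)
      simp only [linStat, sub_mul, mul_sub, sum_sub_distrib, ← sum_mul, ← mul_sum, h1, ← hA,
        sum_const, card_univ, nsmul_eq_mul, ← hndef]
      rw [hS]
      field_simp
      ring
    simp only [hlin]
    rw [expect_linStat_sq _ _ (hcent x) (hcent y) hn, ← hndef, div_le_iff₀ (by linarith)]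
    calc _ ≤ n * n := mul_le_mul (hsq x hx1) (hsq y hy1)
          (sum_nonneg fun i _ => sq_nonneg _) (by linarith)
      _ ≤ 4 * n * (n - 1) := by nlinarith
  have hW2 : 𝔼 π, linStat x y π ^ 2 ≤ 2 * n := by
    have hle : ∀ u : ι → ℝ, (∀ i, |u i| ≤ 1) → ∑ i, u i ^ 2 ≤ n := by
      intro u hu
      refine (sum_le_sum fun i _ => (sq_le_one_iff_abs_le_one _).2 (hu i)).trans ?_
      simp [hndef]
    rw [expect_linStat_sq x y hx hy hn, ← hndef, div_le_iff₀ (by linarith)]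
    calc _ ≤ n * n := mul_le_mul (hle x hx1) (hle y hy1)
          (sum_nonneg fun i _ => sq_nonneg _) (by linarith)
      _ ≤ 2 * n * (n - 1) := by nlinarith
  -- Here ∑ d² - 4AB = 2n(S - AB/n) + 4W², and both terms are controlled in mean by `hVarS` and
  -- `hW2`.
  have hmain : ‖(𝔼 π, s * Complex.I * ((∑ i, ∑ j, d π i j ^ 2 : ℝ) : ℂ) * F π)
      - 4 * n * (s * Complex.I * (A * B / n : ℝ) * 𝔼 π, F π)‖
      ≤ |s| * (4 * n * √n + 8 * n) := by
    rw [mul_expect, mul_expect, ← expect_sub_distrib]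
    have hpt : ∀ π, ‖s * Complex.I * ((∑ i, ∑ j, d π i j ^ 2 : ℝ) : ℂ) * F π
        - 4 * n * (s * Complex.I * (A * B / n : ℝ) * F π)‖
        ≤ |s| * (2 * n * |S π - A * B / n| + 4 * linStat x y π ^ 2) := by
      intro π
      have : (s : ℂ) * Complex.I * ((∑ i, ∑ j, d π i j ^ 2 : ℝ) : ℂ) * F π
          - 4 * n * (s * Complex.I * (A * B / n : ℝ) * F π)
          = (s : ℂ) * Complex.I * ((2 * n * (S π - A * B / n) + 4 * linStat x y π ^ 2 : ℝ) : ℂ)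
            * F π := by
        rw [hsumd]
        have hn0 : (n : ℂ) ≠ 0 := by
          norm_cast; linarith
        push_cast
        field_simp
        ring
      rw [this, norm_mul, norm_mul, norm_mul, hF1, Complex.norm_I, Complex.norm_real,
        Complex.norm_real, mul_one, mul_one, Real.norm_eq_abs, Real.norm_eq_abs]
      gcongr
      refine (abs_add_le _ _).trans ?_
      rw [abs_mul, abs_of_nonneg (by linarith : (0 : ℝ) ≤ 2 * n),
        abs_of_nonneg (by positivity : 0 ≤ 4 * linStat x y π ^ 2)]
    refine (norm_expect_le_of_le hpt).trans ?_
    rw [← mul_expect, expect_add_distrib, ← mul_expect, ← mul_expect]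
    have h4 : √(4 * n) = 2 * √n := by
      rw [Real.sqrt_mul (by norm_num), show (4 : ℝ) = 2 ^ 2 by norm_num,
        Real.sqrt_sq (by norm_num)]
    rw [h4] at hVarS
    refine mul_le_mul_of_nonneg_left ?_ (abs_nonneg s)
    have := mul_le_mul_of_nonneg_left hVarS (by linarith : 0 ≤ 2 * n)
    linarith
  have hfin : ‖4 * (n : ℂ) * ((𝔼 π, (linStat x y π : ℂ) * F π)
      - s * Complex.I * (A * B / n : ℝ) * 𝔼 π, F π)‖
      ≤ 128 * n ^ 2 * s ^ 2 + |s| * (4 * n * √n + 8 * n) := by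
    have hc : ((Fintype.card ι : ℕ) : ℂ) = (n : ℂ) := by rw [hndef]; simp
    rw [hc] at hid
    rw [mul_sub, show 4 * (n : ℂ) * (𝔼 π, (linStat x y π : ℂ) * F π) = _ from hid]
    refine (norm_sub_le_norm_sub_add_norm_sub _ _ _).trans (add_le_add htaylor hmain)
  rw [norm_mul, norm_mul, Complex.norm_real, Real.norm_of_nonneg (by linarith : 0 ≤ n),
    Complex.norm_ofNat] at hfin
  have h4n : 0 < 4 * n := by linarith
  refine le_of_mul_le_mul_left (hfin.trans (le_of_eq ?_)) h4n
  ring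

end CharFun

/-! ### Second moment of the doubly indexed remainder -/

section Residual

variable {ι : Type*} [Fintype ι] [DecidableEq ι]

/-- The mixed second moment of two randomly permuted entries of an array. -/
noncomputable def mixedMoment (b : Matrix ι ι ℝ) (i j k l : ι) : ℝ :=
  𝔼 π : Perm ι, b (π i) (π j) * b (π k) (π l)

lemma mixedMoment_perm (b : Matrix ι ι ℝ) (τ : Perm ι) (i j k l : ι) :
    mixedMoment b (τ i) (τ j) (τ k) (τ l) = mixedMoment b i j k l :=
  expect_comp_mul_right (fun π : Perm ι => b (π i) (π j) * b (π k) (π l)) τ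

lemma abs_mixedMoment_le {b : Matrix ι ι ℝ} {K : ℝ} (hb : ∀ i j, |b i j| ≤ K) (i j k l : ι) :
    |mixedMoment b i j k l| ≤ K ^ 2 := by
  have hK : 0 ≤ K := (abs_nonneg _).trans (hb i j)
  refine (abs_expect_le _ _).trans ((expect_le_expect fun π _ => ?_).trans
    (Fintype.expect_const (ι := Perm ι) (K ^ 2)).le)
  rw [abs_mul, sq]
  exact mul_le_mul (hb _ _) (hb _ _) (abs_nonneg _) hK

lemma sum_mixedMoment {b : Matrix ι ι ℝ} (hb0 : ∀ i, ∑ j, b i j = 0) (i j k : ι) :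
    ∑ l, mixedMoment b i j k l = 0 := by
  simp only [mixedMoment]
  rw [← expect_sum_comm]
  refine expect_eq_zero fun π _ => ?_
  rw [← mul_sum, Equiv.sum_comp π (fun l => b (π k) l), hb0, mul_zero]

/-- The transposition of `l` and `l'` fixes `i`, `j`, `k`. -/
lemma mixedMoment_eq_of_notMem (b : Matrix ι ι ℝ) {i j k l l' : ι}
    (hl : l ∉ ({i, j, k} : Finset ι)) (hl' : l' ∉ ({i, j, k} : Finset ι)) :
    mixedMoment b i j k l = mixedMoment b i j k l' := by
  simp only [mem_insert, mem_singleton, not_or] at hl hl'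
  rw [← mixedMoment_perm b (swap l l') i j k l, swap_apply_left,
    swap_apply_of_ne_of_ne (Ne.symm hl.1) (Ne.symm hl'.1),
    swap_apply_of_ne_of_ne (Ne.symm hl.2.1) (Ne.symm hl'.2.1),
    swap_apply_of_ne_of_ne (Ne.symm hl.2.2) (Ne.symm hl'.2.2)]

/-- Summed over `l`, the moments vanish. At least n - 3 ≥ n/4 equal values off {i, j, k} must
therefore balance at most three values of size K². -/
lemma abs_mixedMoment_le_of_notMem {b : Matrix ι ι ℝ} {K : ℝ} (hb : ∀ i j, |b i j| ≤ K)
    (hb0 : ∀ i, ∑ j, b i j = 0) (hn : 4 ≤ Fintype.card ι) {i j k l : ι}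
    (hl : l ∉ ({i, j, k} : Finset ι)) :
    |mixedMoment b i j k l| ≤ 12 * K ^ 2 / Fintype.card ι := by
  have hn' : (4 : ℝ) ≤ Fintype.card ι := by exact_mod_cast hn
  set s : Finset ι := {i, j, k}
  have hs : (s.card : ℝ) ≤ 3 := by exact_mod_cast card_le_three
  have h := sum_mixedMoment hb0 i j k
  rw [← sum_add_sum_compl s, sum_congr rfl fun l' (hl' : l' ∈ sᶜ) =>
    mixedMoment_eq_of_notMem b (mem_compl.1 hl') hl, sum_const, nsmul_eq_mul] at h
  have h1 : |∑ l' ∈ s, mixedMoment b i j k l'| ≤ s.card * K ^ 2 := by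
    refine (abs_sum_le_sum_abs _ _).trans
      ((sum_le_sum fun l' _ => abs_mixedMoment_le hb i j k l').trans ?_)
    rw [sum_const, nsmul_eq_mul]
  have h2 : |∑ l' ∈ s, mixedMoment b i j k l'| = (sᶜ.card : ℝ) * |mixedMoment b i j k l| := by
    rw [eq_neg_of_add_eq_zero_left h, abs_neg, abs_mul, Nat.abs_cast]
  have h3 : (sᶜ.card : ℝ) = Fintype.card ι - s.card := by
    rw [card_compl, Nat.cast_sub (card_le_univ s)]
  rw [le_div_iff₀ (by linarith)]
  rw [h2, h3] at h1
  have h4 : (Fintype.card ι : ℝ) / 4 ≤ Fintype.card ι - s.card := by linarith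
  have h5 := mul_le_mul_of_nonneg_right h4 (abs_nonneg (mixedMoment b i j k l))
  have h6 := mul_le_mul_of_nonneg_right hs (sq_nonneg K)
  linarith

lemma mixedMoment_comm_left {b : Matrix ι ι ℝ} (hb : b.IsSymm) (i j k l : ι) :
    mixedMoment b i j k l = mixedMoment b j i k l := by
  simp only [mixedMoment, hb.apply]

lemma mixedMoment_comm (b : Matrix ι ι ℝ) (i j k l : ι) :
    mixedMoment b i j k l = mixedMoment b k l i j := by
  simp only [mixedMoment, mul_comm]

/-- The second moment of a quadratic permutation statistic of two arrays with vanishing row sums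
is quadratic in the number of indices. -/
lemma expect_quadratic_sq_le {a b : Matrix ι ι ℝ} {K : ℝ} (ha : ∀ i j, |a i j| ≤ K)
    (hb : ∀ i j, |b i j| ≤ K) (ha0 : ∀ i, ∑ j, a i j = 0) (hb0 : ∀ i, ∑ j, b i j = 0)
    (hbs : b.IsSymm) (hn : 4 ≤ Fintype.card ι) :
    𝔼 π : Perm ι, (∑ i, ∑ j, a i j * b (π i) (π j)) ^ 2
      ≤ 75 * K ^ 4 * (Fintype.card ι : ℝ) ^ 2 := by
  set n : ℝ := ((Fintype.card ι : ℕ) : ℝ) with hndef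
  have hn' : (4 : ℝ) ≤ n := by rw [hndef]; exact_mod_cast hn
  have hexp : 𝔼 π : Perm ι, (∑ i, ∑ j, a i j * b (π i) (π j)) ^ 2
      = ∑ i, ∑ j, ∑ k, ∑ l, a i j * a k l * mixedMoment b i j k l := by
    simp only [mixedMoment, mul_expect, ← expect_sum_comm]
    refine expect_congr rfl fun π _ => ?_
    rw [sq, sum_mul]
    refine sum_congr rfl fun i _ => ?_
    rw [sum_mul]
    refine sum_congr rfl fun j _ => ?_
    rw [mul_sum]
    refine sum_congr rfl fun k _ => ?_
    rw [mul_sum]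
    refine sum_congr rfl fun l _ => ?_
    ring
  set δ := 12 * K ^ 2 / n with hδ
  have hδ0 : 0 ≤ δ := by positivity
  have hex : ∀ i j k : ι, ∃ g : ℝ, |g| ≤ δ ∧ ∀ l ∉ ({i, j, k} : Finset ι),
      mixedMoment b i j k l = g := by
    intro i j k
    obtain ⟨l, hl⟩ : ∃ l, l ∉ ({i, j, k} : Finset ι) := by
      by_contra! h
      have h1 : Fintype.card ι ≤ 3 :=
        (card_le_card fun l _ => h l).trans (card_le_three (a := i) (b := j) (c := k))
      omega
    exact ⟨_, abs_mixedMoment_le_of_notMem hb hb0 hn hl,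
      fun l' hl' => mixedMoment_eq_of_notMem b hl' hl⟩
  choose g hgδ hg using hex
  -- Since the rows of `a` sum to zero, subtracting `g`, constant in `l`, is free. It kills every
  -- term with `l` outside {i, j, k}.
  have hcenter : ∀ i j k, ∑ l, a i j * a k l * mixedMoment b i j k l
      = ∑ l, a i j * a k l * (mixedMoment b i j k l - g i j k) := by
    intro i j k
    simp only [mul_sub, sum_sub_distrib, ← sum_mul, ← mul_sum, ha0]
    ring
  -- Of the O(n³) surviving terms, those with an index occurring only once are O(1/n). Otherwise the
  -- indices coincide in pairs, and there are only O(n²) such terms. The total is K²(6δn³ + 3K²n²) =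
  -- 75K⁴n².
  have hpt : ∀ i j k l, |mixedMoment b i j k l - g i j k|
      ≤ 2 * δ * ((if l = i then 1 else 0) + (if l = j then 1 else 0) + (if l = k then 1 else 0))
        + K ^ 2 * ((if j = i then (if l = k then 1 else 0) else 0)
          + (if k = i then (if l = j then 1 else 0) else 0)
          + (if k = j then (if l = i then 1 else 0) else 0)) := by
    intro i j k l
    have hK2 := sq_nonneg K
    by_cases hl : l ∈ ({i, j, k} : Finset ι)
    · have h1 := abs_sub (mixedMoment b i j k l) (g i j k)
      have h2 := hgδ i j k
      have hone : (1 : ℝ) ≤ (if l = i then 1 else 0) + (if l = j then 1 else 0)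
          + (if l = k then 1 else 0) := by
        simp only [mem_insert, mem_singleton] at hl
        split_ifs <;> first | (norm_num; done) | (exfalso; tauto)
      have hlow : 2 * δ ≤ 2 * δ * ((if l = i then 1 else 0) + (if l = j then 1 else 0)
          + (if l = k then 1 else 0)) := le_mul_of_one_le_right (by linarith) hone
      have hnn : (0 : ℝ) ≤ (if j = i then (if l = k then 1 else 0) else 0)
          + (if k = i then (if l = j then 1 else 0) else 0)
          + (if k = j then (if l = i then 1 else 0) else 0) := by
        split_ifs <;> norm_num
      by_cases hu : i ∈ ({j, k, l} : Finset ι) ∧ j ∈ ({i, k, l} : Finset ι)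
          ∧ k ∈ ({i, j, l} : Finset ι)
      · have hone' : (1 : ℝ) ≤ (if j = i then (if l = k then 1 else 0) else 0)
            + (if k = i then (if l = j then 1 else 0) else 0)
            + (if k = j then (if l = i then 1 else 0) else 0) := by
          simp only [mem_insert, mem_singleton] at hl hu
          split_ifs <;> first | (norm_num; done) | (exfalso; grind)
        have h3 := abs_mixedMoment_le hb i j k l
        have h4 := le_mul_of_one_le_right hK2 hone'
        linarith
      · have h3 : |mixedMoment b i j k l| ≤ δ := by
          -- The symmetries of the moment bring the solitary index into the last slot.
          rw [not_and_or, not_and_or] at hu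
          rcases hu with hu | hu | hu
          · rw [mixedMoment_comm, mixedMoment_comm, mixedMoment_comm_left hbs, mixedMoment_comm]
            refine abs_mixedMoment_le_of_notMem hb hb0 hn ?_
            simp only [mem_insert, mem_singleton] at hu ⊢
            tauto
          · rw [mixedMoment_comm]
            refine abs_mixedMoment_le_of_notMem hb hb0 hn ?_
            simp only [mem_insert, mem_singleton] at hu ⊢
            tauto
          · rw [mixedMoment_comm, mixedMoment_comm_left hbs, mixedMoment_comm]
            refine abs_mixedMoment_le_of_notMem hb hb0 hn ?_
            simp only [mem_insert, mem_singleton] at hu ⊢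
            tauto
        have h4 := mul_nonneg hK2 hnn
        linarith
    · rw [hg i j k l hl, sub_self, abs_zero]
      have : (0 : ℝ) ≤ 2 * δ := by linarith
      refine add_nonneg (mul_nonneg this ?_) (mul_nonneg hK2 ?_) <;> split_ifs <;> norm_num
  rw [hexp]
  simp only [hcenter]
  have hterm : ∀ i j k l, a i j * a k l * (mixedMoment b i j k l - g i j k)
      ≤ K ^ 2 * (2 * δ * ((if l = i then 1 else 0) + (if l = j then 1 else 0)
          + (if l = k then 1 else 0))
        + K ^ 2 * ((if j = i then (if l = k then 1 else 0) else 0)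
          + (if k = i then (if l = j then 1 else 0) else 0)
          + (if k = j then (if l = i then 1 else 0) else 0))) := by
    intro i j k l
    refine (le_abs_self _).trans ?_
    rw [abs_mul]
    refine mul_le_mul ?_ (hpt i j k l) (abs_nonneg _) (sq_nonneg K)
    rw [abs_mul, sq]
    exact mul_le_mul (ha _ _) (ha _ _) (abs_nonneg _) ((abs_nonneg _).trans (ha i j))
  refine (sum_le_sum fun i _ => sum_le_sum fun j _ => sum_le_sum fun k _ => sum_le_sum fun l _ =>
    hterm i j k l).trans (le_of_eq ?_)
  have hin : ∀ i j k : ι, ∑ l, (if k = i then (if l = j then (1 : ℝ) else 0) else 0)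
      = if k = i then 1 else 0 := fun i j k => by split_ifs <;> simp
  simp only [← mul_sum, sum_add_distrib, hin, sum_ite_eq', mem_univ, if_true,
    sum_const, card_univ, nsmul_eq_mul, ← hndef, mul_one]
  rw [hδ]
  field_simp
  ring

end Residual

/-! ### Central limit theorem for the linear part -/

section Linear

variable {ι : Type*} [Fintype ι] [DecidableEq ι]

/-- A quantitative central limit theorem for linear permutation statistics of bounded arrays. -/
lemma norm_expect_exp_linStat_sub_le (x y : ι → ℝ) (hx : ∑ i, x i = 0) (hy : ∑ i, y i = 0)
    (hx1 : ∀ i, |x i| ≤ 1) (hy1 : ∀ i, |y i| ≤ 1) (hn : 2 ≤ Fintype.card ι) {c σ : ℝ}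
    (hc : 0 < c) (hσ : c * √(Fintype.card ι) ≤ σ)
    (hσ2 : σ ^ 2 = (∑ i, x i ^ 2) * (∑ i, y i ^ 2) / Fintype.card ι) (t : ℝ) :
    ‖(𝔼 π, Complex.exp (t / σ * linStat x y π * Complex.I)) - Complex.exp (-(t : ℂ) ^ 2 / 2)‖
      ≤ |t| * Real.exp (t ^ 2 / 2) * ((3 * |t| / c ^ 2 + 32 * t ^ 2 / c ^ 3)
        / √(Fintype.card ι)) := by
  have hn2 : (2 : ℝ) ≤ Fintype.card ι := by exact_mod_cast hn
  set q : ℝ := √(Fintype.card ι) with hq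
  have hqsq : q ^ 2 = Fintype.card ι := Real.sq_sqrt (by linarith)
  have hq1 : 1 ≤ q := by rw [hq, Real.one_le_sqrt]; linarith
  have hσ0 : 0 < σ := lt_of_lt_of_le (by positivity) hσ
  have hσC : (σ : ℂ) ≠ 0 := by exact_mod_cast hσ0.ne'
  have hderiv : ∀ u : ℝ, HasDerivAt
      (fun u : ℝ => 𝔼 π, Complex.exp (u / σ * linStat x y π * Complex.I))
      (Complex.I / σ * 𝔼 π, (linStat x y π : ℂ) * Complex.exp (u / σ * linStat x y π * Complex.I))
      u := by
    intro u
    have h1 : ∀ π, HasDerivAt (fun u : ℝ => Complex.exp (u / σ * linStat x y π * Complex.I))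
        (Complex.I / σ * ((linStat x y π : ℂ)
          * Complex.exp (u / σ * linStat x y π * Complex.I))) u := by
      intro π
      have h2 : HasDerivAt (fun u : ℝ => (u : ℂ) / σ * linStat x y π * Complex.I)
          (1 / σ * linStat x y π * Complex.I) u :=
        (((Complex.ofRealCLM.hasDerivAt (x := u)).div_const _).mul_const _).mul_const _
      refine h2.cexp.congr_deriv ?_
      ring
    rw [mul_expect]
    simp only [Fintype.expect_eq_sum_div_card]
    exact (HasDerivAt.fun_sum fun π _ => h1 π).div_const _
  refine norm_sub_exp_neg_sq_le hderiv ?_ fun u hu => ?_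
  · simp only [Complex.ofReal_zero, zero_div, zero_mul, Complex.exp_zero]
    exact Fintype.expect_const _
  · have h := norm_expect_linStat_mul_exp_sub_le x y hx hy hx1 hy1 hn (u / σ)
    rw [← hσ2, ← hqsq, Real.sqrt_sq (by linarith)] at h
    push_cast at h
    set M := 𝔼 π, (linStat x y π : ℂ) * Complex.exp (u / σ * linStat x y π * Complex.I)
    set G := 𝔼 π, Complex.exp (u / σ * linStat x y π * Complex.I)
    have heq : Complex.I / σ * M + u * G
        = Complex.I / σ * (M - u / σ * Complex.I * (σ : ℂ) ^ 2 * G) := by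
      field_simp
      ring_nf
      simp
    rw [heq, norm_mul, norm_div, Complex.norm_I, Complex.norm_real, Real.norm_of_nonneg hσ0.le]
    have hu2 : u ^ 2 ≤ t ^ 2 := sq_le_sq.2 hu
    calc 1 / σ * ‖M - u / σ * Complex.I * (σ : ℂ) ^ 2 * G‖
        ≤ 1 / σ * (|u / σ| * (q + 2) + 32 * q ^ 2 * (u / σ) ^ 2) := by gcongr
      _ = |u| * (q + 2) / σ ^ 2 + 32 * q ^ 2 * u ^ 2 / σ ^ 3 := by
          rw [abs_div, abs_of_pos hσ0]
          field_simp
      -- Uses `q + 2 ≤ 3 * q`, as `1 ≤ q`, and `c * q ≤ σ`.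
      _ ≤ |t| * (3 * q) / (c * q) ^ 2 + 32 * q ^ 2 * t ^ 2 / (c * q) ^ 3 := by
          gcongr
          linarith
      _ = (3 * |t| / c ^ 2 + 32 * t ^ 2 / c ^ 3) / q := by
          field_simp

end Linear

/-! ### Additive part plus remainder, and the bounded case -/

section Decomposition

variable {ι : Type*} [Fintype ι]

/-- The array obtained from `a` by subtracting its additive part. -/
noncomputable def centered (a : Matrix ι ι ℝ) : Matrix ι ι ℝ :=
  fun i j => a i j - ((∑ k, a i k) + ∑ k, a j k) / Fintype.card ι

lemma centered_isSymm {a : Matrix ι ι ℝ} (ha : a.IsSymm) : (centered a).IsSymm := by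
  ext i j
  simp only [Matrix.transpose_apply, centered, ha.apply i j]
  ring

lemma sum_centered [Nonempty ι] {a : Matrix ι ι ℝ} (h0 : ∑ i, ∑ j, a i j = 0) (i : ι) :
    ∑ j, centered a i j = 0 := by
  simp only [centered, sum_sub_distrib, ← sum_div, sum_add_distrib, h0, sum_const, card_univ,
    nsmul_eq_mul]
  field_simp
  ring

lemma abs_sum_row_le {a : Matrix ι ι ℝ} (h1 : ∀ i j, |a i j| ≤ 1) (i : ι) :
    |∑ j, a i j| ≤ Fintype.card ι := by
  refine (abs_sum_le_sum_abs _ _).trans ((sum_le_sum fun j _ => h1 i j).trans ?_)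
  simp

lemma abs_centered_le {a : Matrix ι ι ℝ} (h1 : ∀ i j, |a i j| ≤ 1) (i j : ι) :
    |centered a i j| ≤ 3 := by
  have : Nonempty ι := ⟨i⟩
  have hn : (0 : ℝ) < Fintype.card ι := by exact_mod_cast Fintype.card_pos
  have h2 : |((∑ k, a i k) + ∑ k, a j k) / Fintype.card ι| ≤ 2 := by
    rw [abs_div, Nat.abs_cast, div_le_iff₀ hn]
    exact (abs_add_le _ _).trans (by linarith [abs_sum_row_le h1 i, abs_sum_row_le h1 j])
  exact (abs_sub _ _).trans (by linarith [h1 i j])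

/-- Because the row sums of `a` add up to zero, the additive part of either array is orthogonal to
the centred part of the other. -/
lemma sum_mul_eq_add_sum_centered [Nonempty ι] {a c : Matrix ι ι ℝ} (ha : a.IsSymm)
    (hc : c.IsSymm) (ha0 : ∑ i, ∑ j, a i j = 0) :
    ∑ i, ∑ j, a i j * c i j = 2 / Fintype.card ι * ∑ i, (∑ j, a i j) * (∑ j, c i j)
      + ∑ i, ∑ j, centered a i j * centered c i j := by
  set r : ι → ℝ := fun i => ∑ j, a i j with hr
  set s : ι → ℝ := fun i => ∑ j, c i j with hs
  have hr0 : ∑ i, r i = 0 := ha0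
  have e1 : ∑ i, ∑ j, a i j * s i = ∑ i, r i * s i := by simp only [← sum_mul, hr]
  have e2 : ∑ i, ∑ j, a i j * s j = ∑ i, r i * s i := by
    rw [sum_comm, ← e1]
    exact sum_congr rfl fun i _ => sum_congr rfl fun j _ => by rw [ha.apply]
  have e3 : ∑ i, ∑ j, r i * c i j = ∑ i, r i * s i := by simp only [← mul_sum, hs]
  have e4 : ∑ i, ∑ j, r j * c i j = ∑ i, r i * s i := by
    rw [sum_comm, ← e3]
    exact sum_congr rfl fun i _ => sum_congr rfl fun j _ => by rw [hc.apply]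
  have e5 : ∑ i, ∑ j, (r i + r j) * (s i + s j) = 2 * Fintype.card ι * ∑ i, r i * s i := by
    have h : ∀ i j, (r i + r j) * (s i + s j) = r i * s i + r j * s j + r i * s j + s i * r j :=
      fun i j => by ring
    simp only [h, sum_add_distrib, sum_const, card_univ, nsmul_eq_mul]
    simp only [← mul_sum, ← sum_mul, hr0]
    ring
  have hn : (Fintype.card ι : ℝ) ≠ 0 := by exact_mod_cast Fintype.card_ne_zero
  have hexp : ∀ i j, centered a i j * centered c i j = a i j * c i j
      - (a i j * s i + a i j * s j) / Fintype.card ι - (r i * c i j + r j * c i j) / Fintype.card ι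
      + (r i + r j) * (s i + s j) / (Fintype.card ι : ℝ) ^ 2 := by
    intro i j
    simp only [centered, hr, hs]
    field_simp
    ring
  simp only [hexp, sum_add_distrib, sum_sub_distrib, ← sum_div, e1, e2, e3, e4, e5]
  field_simp
  ring

/-- Centring commutes with simultaneous permutation of rows and columns, so the orthogonal splitting
applies to `b` permuted by `π`. -/
lemma gammaStat_eq {N : ℕ} [NeZero N] {a b : Matrix (Fin N) (Fin N) ℝ} (ha : a.IsSymm)
    (hb : b.IsSymm) (ha0 : ∑ i, ∑ j, a i j = 0) (π : Perm (Fin N)) :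
    gammaStat a b π = 2 / N * linStat (fun i => ∑ j, a i j) (fun i => ∑ j, b i j) π
      + ∑ i, ∑ j, centered a i j * centered b (π i) (π j) := by
  have hrow : ∀ i, ∑ j, b i (π j) = ∑ j, b i j := fun i => Equiv.sum_comp π (b i)
  have h := sum_mul_eq_add_sum_centered (c := b.submatrix π π) ha (hb.submatrix π) ha0
  simp only [centered, Matrix.submatrix_apply, hrow, Fintype.card_fin] at h ⊢
  exact h

lemma tripleSum_eq {N : ℕ} (a : Matrix (Fin N) (Fin N) ℝ) :
    tripleSum a = ∑ i, (∑ j, a i j) ^ 2 := by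
  simp only [tripleSum, sq, sum_mul_sum]

/-- The characteristic function of the standardized statistic, for arrays with entries of absolute
value at most one. -/
lemma norm_expect_exp_gammaStat_sub_le {N : ℕ} (hN : 4 ≤ N) {a b : Matrix (Fin N) (Fin N) ℝ}
    (ha : a.IsSymm) (hb : b.IsSymm) (ha0 : ∑ i, ∑ j, a i j = 0) (hb0 : ∑ i, ∑ j, b i j = 0)
    (ha1 : ∀ i j, |a i j| ≤ 1) (hb1 : ∀ i j, |b i j| ≤ 1) {c : ℝ} (hc : 0 < c)
    (hac : c * (N : ℝ) ^ 3 ≤ tripleSum a) (hbc : c * (N : ℝ) ^ 3 ≤ tripleSum b) (t : ℝ) :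
    ‖(𝔼 π, Complex.exp (t * (gammaStat a b π
        / (2 * √(tripleSum a * tripleSum b / (N : ℝ) ^ 3)) : ℝ) * Complex.I))
      - Complex.exp (-(t : ℂ) ^ 2 / 2)‖
      ≤ (|t| * (39 / c) + |t| * Real.exp (t ^ 2 / 2) * (3 * |t| / c ^ 2 + 32 * t ^ 2 / c ^ 3))
        / √N := by
  have hN4 : (4 : ℝ) ≤ N := by exact_mod_cast hN
  have hN0 : (0 : ℝ) < N := by linarith
  have : NeZero N := ⟨by omega⟩
  set q : ℝ := √N with hq
  have hqsq : q ^ 2 = N := Real.sq_sqrt hN0.le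
  have hq0 : 0 < q := Real.sqrt_pos.2 hN0
  set x : Fin N → ℝ := fun i => (∑ j, a i j) / N with hx
  set y : Fin N → ℝ := fun i => (∑ j, b i j) / N with hy
  have hrow : ∀ {u : Matrix (Fin N) (Fin N) ℝ}, (∀ i j, |u i j| ≤ 1) →
      ∀ i, |(∑ j, u i j) / (N : ℝ)| ≤ 1 := by
    intro u hu i
    rw [abs_div, Nat.abs_cast, div_le_one hN0]
    simpa using abs_sum_row_le hu i
  -- The power 5 reflects `tripleSum a = N² ∑ x_i²`, likewise for `b`, and σ² = ∑ x² ∑ y² / N.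
  set σ : ℝ := √(tripleSum a * tripleSum b / (N : ℝ) ^ 5) with hσ
  have hTa : 0 ≤ tripleSum a := le_trans (by positivity) hac
  have hTb : 0 ≤ tripleSum b := le_trans (by positivity) hbc
  have hσlow : c * q ≤ σ := by
    refine Real.le_sqrt_of_sq_le ?_
    rw [mul_pow, hqsq, le_div_iff₀ (by positivity)]
    calc c ^ 2 * N * (N : ℝ) ^ 5 = (c * (N : ℝ) ^ 3) * (c * (N : ℝ) ^ 3) := by ring
      _ ≤ _ := mul_le_mul hac hbc (by positivity) hTa
  have hσ0 : 0 < σ := lt_of_lt_of_le (by positivity) hσlow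
  have hs : √(tripleSum a * tripleSum b / (N : ℝ) ^ 3) = N * σ := by
    have h1 : tripleSum a * tripleSum b / (N : ℝ) ^ 3
        = (N : ℝ) ^ 2 * (tripleSum a * tripleSum b / (N : ℝ) ^ 5) := by
      field_simp
    rw [h1, Real.sqrt_mul (by positivity), Real.sqrt_sq hN0.le]
  have hσ2 : σ ^ 2 = (∑ i, x i ^ 2) * (∑ i, y i ^ 2) / (Fintype.card (Fin N) : ℝ) := by
    rw [hσ, Real.sq_sqrt (by positivity), tripleSum_eq, tripleSum_eq, Fintype.card_fin]
    simp only [hx, hy, div_pow, ← sum_div]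
    field_simp
  have hlin := norm_expect_exp_linStat_sub_le x y (by rw [hx, ← sum_div, ha0, zero_div])
    (by rw [hy, ← sum_div, hb0, zero_div]) (hrow ha1) (hrow hb1)
    (by rw [Fintype.card_fin]; omega) hc (by rw [Fintype.card_fin]; exact hσlow) hσ2 t
  rw [Fintype.card_fin, ← hq] at hlin
  set R : Perm (Fin N) → ℝ := fun π => ∑ i, ∑ j, centered a i j * centered b (π i) (π j) with hR
  have hdec : ∀ π, gammaStat a b π / (2 * √(tripleSum a * tripleSum b / (N : ℝ) ^ 3))
      = linStat x y π / σ + R π / (2 * N * σ) := by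
    intro π
    have h1 : linStat (fun i => ∑ j, a i j) (fun i => ∑ j, b i j) π
        = (N : ℝ) ^ 2 * linStat x y π := by
      simp only [linStat, hx, hy]
      rw [mul_sum]
      refine sum_congr rfl fun i _ => ?_
      field_simp
    rw [gammaStat_eq ha hb ha0, h1, hs]
    simp only [hR]
    field_simp
  -- Centred entries are at most 3 in absolute value, and 75 · 3⁴ = 6075 ≤ 78².
  have hR1 : 𝔼 π, |R π| ≤ 78 * N := by
    refine (expect_abs_le_sqrt R).trans (Real.sqrt_le_iff.2 ⟨by positivity, ?_⟩)
    have h := expect_quadratic_sq_le (abs_centered_le ha1) (abs_centered_le hb1)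
      (sum_centered ha0) (sum_centered hb0) (centered_isSymm hb)
      (by rw [Fintype.card_fin]; exact hN)
    rw [Fintype.card_fin] at h
    refine h.trans ?_
    nlinarith [sq_nonneg (N : ℝ)]
  have hdiff : ‖(𝔼 π, Complex.exp (t * (gammaStat a b π
        / (2 * √(tripleSum a * tripleSum b / (N : ℝ) ^ 3)) : ℝ) * Complex.I))
      - 𝔼 π, Complex.exp (t / σ * linStat x y π * Complex.I)‖ ≤ |t| * (39 / c) / q := by
    rw [← expect_sub_distrib]
    refine (norm_expect_le_of_le (g := fun π => |t| / (2 * N * σ) * |R π|) fun π => ?_).trans ?_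
    · have h1 : Complex.exp (t * (gammaStat a b π
          / (2 * √(tripleSum a * tripleSum b / (N : ℝ) ^ 3)) : ℝ) * Complex.I)
          - Complex.exp (t / σ * linStat x y π * Complex.I)
          = Complex.exp ((t / σ * linStat x y π : ℝ) * Complex.I)
            * (Complex.exp (Complex.I * (t * (R π / (2 * N * σ)) : ℝ)) - 1) := by
        rw [mul_sub, mul_one, ← Complex.exp_add, hdec]
        push_cast
        congr 2
        ring
      rw [h1, norm_mul, Complex.norm_exp_ofReal_mul_I, one_mul]
      refine Real.norm_exp_I_mul_ofReal_sub_one_le.trans (le_of_eq ?_)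
      rw [Real.norm_eq_abs, abs_mul, abs_div, abs_of_pos (by positivity : 0 < 2 * N * σ)]
      ring
    · rw [← mul_expect]
      calc |t| / (2 * N * σ) * 𝔼 π, |R π| ≤ |t| / (2 * N * (c * q)) * (78 * N) := by gcongr
        _ = |t| * (39 / c) / q := by field_simp; ring
  refine (norm_sub_le_norm_sub_add_norm_sub _ _ _).trans ((add_le_add hdiff hlin).trans
    (le_of_eq ?_))
  ring

end Decomposition

/-! ### Reduction to entries bounded by one -/

section Scaling

variable {N : ℕ}

lemma abs_le_maxAbs (a : Matrix (Fin N) (Fin N) ℝ) (i j : Fin N) : |a i j| ≤ maxAbs a :=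
  le_ciSup (f := fun p : Fin N × Fin N => |a p.1 p.2|) (Set.finite_range _).bddAbove (i, j)

lemma maxAbs_pos {a : Matrix (Fin N) (Fin N) ℝ} (ha : a ≠ 0) : 0 < maxAbs a := by
  obtain ⟨i, j, hij⟩ : ∃ i j, a i j ≠ 0 := by
    by_contra! h
    exact ha (Matrix.ext h)
  exact (abs_pos.2 hij).trans_le (abs_le_maxAbs a i j)

lemma tripleSum_smul (m : ℝ) (a : Matrix (Fin N) (Fin N) ℝ) :
    tripleSum (m • a) = m ^ 2 * tripleSum a := by
  simp only [tripleSum_eq, Matrix.smul_apply, smul_eq_mul, ← mul_sum, mul_pow]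

lemma gammaStat_smul_smul (m k : ℝ) (a b : Matrix (Fin N) (Fin N) ℝ) (π : Perm (Fin N)) :
    gammaStat (m • a) (k • b) π = m * k * gammaStat a b π := by
  simp only [gammaStat, Matrix.smul_apply, smul_eq_mul, mul_sum]
  exact sum_congr rfl fun i _ => sum_congr rfl fun j _ => by ring

lemma standardized_smul_smul {m k : ℝ} (hm : 0 < m) (hk : 0 < k)
    (a b : Matrix (Fin N) (Fin N) ℝ) (π : Perm (Fin N)) :
    gammaStat (m • a) (k • b) π
        / (2 * √(tripleSum (m • a) * tripleSum (k • b) / (N : ℝ) ^ 3))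
      = gammaStat a b π / (2 * √(tripleSum a * tripleSum b / (N : ℝ) ^ 3)) := by
  rw [gammaStat_smul_smul, tripleSum_smul, tripleSum_smul,
    show m ^ 2 * tripleSum a * (k ^ 2 * tripleSum b) / (N : ℝ) ^ 3
      = (m * k) ^ 2 * (tripleSum a * tripleSum b / (N : ℝ) ^ 3) by ring,
    Real.sqrt_mul (sq_nonneg _), Real.sqrt_sq (by positivity), mul_left_comm 2 (m * k),
    mul_div_mul_left _ _ (by positivity)]

end Scaling

/-! ### Passage to convergence in distribution -/

lemma integral_permMeasure {N : ℕ} (F : Perm (Fin N) → ℂ) :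
    ∫ π, F π ∂permMeasure N = 𝔼 π, F π := by
  have : MeasurableSingletonClass (Perm (Fin N)) := ⟨fun _ => trivial⟩
  rw [permMeasure, PMF.integral_eq_sum, Fintype.expect_eq_sum_div_card, sum_div]
  refine sum_congr rfl fun π _ => ?_
  simp [PMF.uniformOfFintype_apply, div_eq_inv_mul]

lemma exists_eventually_le_tripleSum {a : (N : ℕ) → Matrix (Fin N) (Fin N) ℝ}
    (ha : (fun N => tripleSum (a N)) =Θ[atTop] (fun N => (N : ℝ) ^ 3 * maxAbs (a N) ^ 2)) :
    ∃ c > 0, ∀ᶠ N : ℕ in atTop, c * ((N : ℝ) ^ 3 * maxAbs (a N) ^ 2) ≤ tripleSum (a N) := by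
  obtain ⟨C, hC, h⟩ := ha.2.exists_pos
  refine ⟨C⁻¹, inv_pos.2 hC, h.bound.mono fun N hN => ?_⟩
  have hT : 0 ≤ tripleSum (a N) := by
    rw [tripleSum_eq]; exact sum_nonneg fun i _ => sq_nonneg _
  rw [Real.norm_of_nonneg (by positivity), Real.norm_of_nonneg hT] at hN
  rwa [inv_mul_le_iff₀ hC]

end GenCorr

theorem theorem5
    (a b : (N : ℕ) → Matrix (Fin N) (Fin N) ℝ)
    (ha_symm : ∀ N, (a N).IsSymm) (hb_symm : ∀ N, (b N).IsSymm)
    (ha_sum : ∀ N, ∑ i, ∑ j, a N i j = 0) (hb_sum : ∀ N, ∑ i, ∑ j, b N i j = 0)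
    (ha_ne : ∀ᶠ N in atTop, a N ≠ 0) (hb_ne : ∀ᶠ N in atTop, b N ≠ 0)
    (ha : (fun N => GenCorr.tripleSum (a N))
      =Θ[atTop] (fun N => (N : ℝ) ^ 3 * GenCorr.maxAbs (a N) ^ 2))
    (hb : (fun N => GenCorr.tripleSum (b N))
      =Θ[atTop] (fun N => (N : ℝ) ^ 3 * GenCorr.maxAbs (b N) ^ 2)) :
    TendstoInDistribution
      (fun (N : ℕ) (π : Equiv.Perm (Fin N)) => GenCorr.gammaStat (a N) (b N) π /
        (2 * √(GenCorr.tripleSum (a N) * GenCorr.tripleSum (b N) / (N : ℝ) ^ 3)))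
      atTop (id : ℝ → ℝ) GenCorr.permMeasure (gaussianReal 0 1) := by
  have hmeas : ∀ (N : ℕ) (X : Equiv.Perm (Fin N) → ℝ), Measurable X := fun N X s _ => trivial
  refine ⟨fun N => (hmeas N _).aemeasurable, aemeasurable_id, ?_⟩
  -- Lévy's continuity theorem: a bound of order N^{-1/2} at each fixed `t` suffices.
  refine ProbabilityMeasure.tendsto_iff_tendsto_charFun.2 fun t => ?_
  simp only [ProbabilityMeasure.coe_mk, Measure.map_id, charFun_gaussianReal]
  obtain ⟨ca, hca, hca'⟩ := GenCorr.exists_eventually_le_tripleSum ha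
  obtain ⟨cb, hcb, hcb'⟩ := GenCorr.exists_eventually_le_tripleSum hb
  set c := min ca cb
  have hc : 0 < c := lt_min hca hcb
  rw [tendsto_iff_norm_sub_tendsto_zero]
  have hlim : Tendsto (fun N : ℕ => (|t| * (39 / c)
      + |t| * Real.exp (t ^ 2 / 2) * (3 * |t| / c ^ 2 + 32 * t ^ 2 / c ^ 3)) / √(N : ℝ))
      atTop (nhds 0) :=
    tendsto_const_nhds.div_atTop (Real.tendsto_sqrt_atTop.comp tendsto_natCast_atTop_atTop)
  refine squeeze_zero' (Eventually.of_forall fun N => norm_nonneg _) ?_ hlim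
  filter_upwards [ha_ne, hb_ne, hca', hcb', eventually_ge_atTop 4] with N hane hbne hTa hTb hN
  have hm := GenCorr.maxAbs_pos hane
  have hk := GenCorr.maxAbs_pos hbne
  have hentry : ∀ u : Matrix (Fin N) (Fin N) ℝ, 0 < GenCorr.maxAbs u →
      ∀ i j, |((GenCorr.maxAbs u)⁻¹ • u) i j| ≤ 1 := by
    intro u hu i j
    rw [Matrix.smul_apply, smul_eq_mul, abs_mul, abs_inv, abs_of_pos hu, inv_mul_le_iff₀ hu,
      mul_one]
    exact GenCorr.abs_le_maxAbs u i j
  have hsum : ∀ (m : ℝ) (u : Matrix (Fin N) (Fin N) ℝ), ∑ i, ∑ j, u i j = 0 →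
      ∑ i, ∑ j, (m • u) i j = 0 := by
    intro m u hu
    simp only [Matrix.smul_apply, smul_eq_mul, ← Finset.mul_sum, hu, mul_zero]
  have htriple : ∀ (u : Matrix (Fin N) (Fin N) ℝ) (d : ℝ), 0 < GenCorr.maxAbs u → c ≤ d →
      d * ((N : ℝ) ^ 3 * GenCorr.maxAbs u ^ 2) ≤ GenCorr.tripleSum u →
      c * (N : ℝ) ^ 3 ≤ GenCorr.tripleSum ((GenCorr.maxAbs u)⁻¹ • u) := by
    intro u d hu hd h
    rw [GenCorr.tripleSum_smul, inv_pow, le_inv_mul_iff₀ (by positivity)]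
    refine le_trans ?_ h
    calc _ = c * ((N : ℝ) ^ 3 * GenCorr.maxAbs u ^ 2) := by ring
      _ ≤ _ := by gcongr
  have hmain := GenCorr.norm_expect_exp_gammaStat_sub_le hN
    ((ha_symm N).smul (GenCorr.maxAbs (a N))⁻¹) ((hb_symm N).smul (GenCorr.maxAbs (b N))⁻¹)
    (hsum _ _ (ha_sum N)) (hsum _ _ (hb_sum N)) (hentry _ hm) (hentry _ hk) hc
    (htriple _ _ hm (min_le_left _ _) hTa) (htriple _ _ hk (min_le_right _ _) hTb) t
  simp only [GenCorr.standardized_smul_smul (inv_pos.2 hm) (inv_pos.2 hk)] at hmain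
  rw [charFun_apply_real, integral_map (hmeas N _).aemeasurable (by fun_prop),
    GenCorr.integral_permMeasure]
  have hexp : Complex.exp (t * (0 : ℝ) * Complex.I - ((1 : NNReal) : ℝ) * (t : ℂ) ^ 2 / 2)
      = Complex.exp (-(t : ℂ) ^ 2 / 2) := by
    congr 1
    push_cast
    ring
  rw [hexp]
  exact hmain
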